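/- Let $G_0$ denote a sub-Gaussian probability distribution on $\mathbb{R}$ with mean $0$ and variance $1$. There is an absolute constant $c_2>0$ and, for every such $G_0$, there are numbers $c_1,c_3>0$ depending only on $G_0$, such that the following holds. Let $n,p\ge 1$ be integers with $\log(pe/n)\le n\le p$, let $x\in\mathbb{R}^p\setminus\{0\}$, $\sigma\ge 0$ and $\epsilon_0\in\mathbb{R}$. Let $A\in\mathbb{R}^{n\times p}$ be a random matrix whose entries are an i.i.d. sample from $\frac{1}{\sqrt n}G_0$ (the law of $g/\sqrt n$ with $g\sim G_0$), and let $\epsilon$ be a random vector in $\mathbb{R}^n$, defined on the same probability space as $A$, all of whose realizations satisfy $\|\epsilon\|_2\le\epsilon_0$. Put $y=Ax+\sigma\epsilon$. Then with probability at least $1-2\exp(-c_1n)$ (with respect to the joint distribution of $A$ and $\epsilon$), every solution $$\hat x\in\operatorname{argmin}\big\{\|v\|_1 : \|Av-y\|_2\le\sigma\epsilon_0,\ v\in\mathbb{R}^p\big\}$$ of the Basis Pursuit Denoising problem satisfies $$\frac{\|\hat x-x\|_2}{\|x\|_2}\le c_2\,\frac{\sigma\epsilon_0}{\|x\|_2}+c_3\sqrt{\frac{s_2(x)\,\log(pe/n)}{n}},$$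 where $s_2(x)=\|x\|_1^2/\|x\|_2^2$ is the numerical sparsity of $x$ of order $2$, i.e. $s_2(x)=\exp(H_2(\pi(x)))$ with $\pi_j(x)=|x_j|/\|x\|_1$ and $H_2(\pi)=-\log\sum_j\pi_j^2$ the Rényi entropy of order $2$. -/

import Mathlib

open MeasureTheory ProbabilityTheory
open scoped BigOperators NNReal

noncomputable section

/-- The `ℓ₁` norm of a vector of `ℝ^p`. (The `ℓ₂` norm is the norm of `EuclideanSpace`.) -/
def l1Norm {p : ℕ} (v : EuclideanSpace ℝ (Fin p)) : ℝ :=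
  ∑ i, |v i|

/-- The weights `π_j(x) = |x_j| / ‖x‖₁` that a nonzero vector puts on the index set. -/
def inducedDist {p : ℕ} (x : EuclideanSpace ℝ (Fin p)) (j : Fin p) : ℝ :=
  |x j| / l1Norm x

/-- The Rényi entropy `(1 - q)⁻¹ log (∑ π_i^q)` of order `q ∈ (0, ∞)`, `q ≠ 1`. -/
def renyiEntropy {p : ℕ} (q : ℝ) (w : Fin p → ℝ) : ℝ :=
  1 / (1 - q) * Real.log (∑ i, w i ^ q)

open Classical in
/-- The numerical sparsity `s_q(x)` of order `q ∈ (0, ∞)`, `q ≠ 1`: the exponential of the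
Rényi entropy of the induced distribution, and `0` at `x = 0`. -/
def numericalSparsity {p : ℕ} (q : ℝ) (x : EuclideanSpace ℝ (Fin p)) : ℝ :=
  if x = 0 then 0 else Real.exp (renyiEntropy q (inducedDist x))

/-- For `q = 2` the numerical sparsity is `‖x‖₁² / ‖x‖₂²`. -/
theorem numericalSparsity_two {p : ℕ} (x : EuclideanSpace ℝ (Fin p)) :
    numericalSparsity 2 x = l1Norm x ^ 2 / ‖x‖ ^ 2 := by
  unfold numericalSparsity
  split_ifs with h
  · simp [h]
  · have h2 : 0 < ‖x‖ ^ 2 := by positivity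
    have h1 : 0 < l1Norm x := by
      obtain ⟨i, hi⟩ : ∃ i, x i ≠ 0 := by
        by_contra! hc
        exact h (by ext i; simpa using hc i)
      exact Finset.sum_pos' (fun _ _ => abs_nonneg _) ⟨i, Finset.mem_univ i, abs_pos.mpr hi⟩
    have hs : ∑ i, inducedDist x i ^ (2 : ℝ) = ‖x‖ ^ 2 / l1Norm x ^ 2 := by
      rw [EuclideanSpace.real_norm_sq_eq, Finset.sum_div]
      refine Finset.sum_congr rfl fun i _ => ?_
      rw [Real.rpow_two, inducedDist, div_pow, sq_abs]
    have hpos : 0 < ‖x‖ ^ 2 / l1Norm x ^ 2 := by positivity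
    rw [renyiEntropy, hs]
    have he : (1 : ℝ) / (1 - 2) = -1 := by norm_num
    rw [he, neg_one_mul, Real.exp_neg, Real.exp_log hpos, inv_div]

/-- `G` is a sub-Gaussian probability distribution on `ℝ` with mean `0` and variance `1`. -/
structure IsStandardSubGaussian (G : Measure ℝ) : Prop where
  isProbabilityMeasure : IsProbabilityMeasure G
  subGaussian : ∃ K : ℝ≥0, HasSubgaussianMGF id K G
  mean_eq_zero : ∫ g, g ∂G = 0
  variance_eq_one : variance id G = 1

/-- The entries of the random matrix `A` are an i.i.d. sample from `n^{-1/2} G`, that is, from the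
law of `g / √n` for `g` distributed as `G`. -/
structure IsIIDScaledSample {Ω : Type*} [MeasurableSpace Ω] (P : Measure Ω) {n p : ℕ}
    (G : Measure ℝ) (A : Ω → Matrix (Fin n) (Fin p) ℝ) : Prop where
  indep : iIndepFun (fun (ij : Fin n × Fin p) (ω : Ω) => A ω ij.1 ij.2) P
  law : ∀ i j, HasLaw (fun ω => A ω i j) (G.map fun g => g / √(n : ℝ)) P

/-- `v` solves the Basis Pursuit Denoising problem
`argmin { ‖v‖₁ : ‖A v - y‖₂ ≤ r, v ∈ ℝ^p }`. -/
def IsBPDNSolution {n p : ℕ} (A : Matrix (Fin n) (Fin p) ℝ) (y : EuclideanSpace ℝ (Fin n)) (r : ℝ)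
    (v : EuclideanSpace ℝ (Fin p)) : Prop :=
  ‖A.toEuclideanLin v - y‖ ≤ r ∧
    ∀ w : EuclideanSpace ℝ (Fin p), ‖A.toEuclideanLin w - y‖ ≤ r → l1Norm v ≤ l1Norm w

end

/-! Put h = x̂ - x. Since x is feasible and x̂ is minimal, ‖h‖₁ ≤ 2‖x‖₁ and ‖Ah‖ ≤ 2σε₀. It
therefore suffices that, with high probability, every h satisfies ‖h‖ ≤ 2‖Ah‖ + C‖h‖₁√(log(pe/n)/n),
which is `IsStandardSubGaussian.exists_norm_le`. Since √s₂(x) = ‖x‖₁/‖x‖, dividing by ‖x‖ gives the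
claim.

This inequality follows from a crude two-sided isometry bound on k-sparse vectors, k being of order
n/log(pe/n). Cutting h into blocks of k entries of decreasing modulus makes everything beyond the
first block cost only ‖h‖₁/√k (`norm_le_of_restricted_isometry`).

The isometry bound comes from a union bound over nets of all k-dimensional coordinate spheres
(`exists_event_restricted_isometry`). For a fixed unit vector the coordinates of √n·Av are
independent and sub-Gaussian with unit second moment, so Chernoff bounds on their squares give
failure probability exp(-κn) (`IsStandardSubGaussian.exists_tail_bounds`). This beats the number of
net points (`choose_mul_pow_le_exp`). -/

/-! ### Nets of the unit sphere. -/

/-- A finite `ε`-separated subset of the closed unit ball has at most `(1 + 2 / ε) ^ dim` points. -/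
theorem card_le_of_separated_of_norm_le_one {E : Type*} [NormedAddCommGroup E] [NormedSpace ℝ E]
    [FiniteDimensional ℝ E] {ε : ℝ} (hε : 0 < ε) (s : Finset E) (hs : ∀ c ∈ s, ‖c‖ ≤ 1)
    (h : ∀ c ∈ s, ∀ d ∈ s, c ≠ d → ε ≤ ‖c - d‖) :
    (s.card : ℝ) ≤ (1 + 2 / ε) ^ Module.finrank ℝ E := by
  borelize E
  let μ : Measure E := Measure.addHaar
  have hδ : 0 < ε / 2 := by positivity
  have hρ : 0 < 1 + ε / 2 := by positivity
  have hdisj : (s : Set E).PairwiseDisjoint fun c => Metric.ball c (ε / 2) := by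
    intro c hc d hd hcd
    apply Metric.ball_disjoint_ball
    rw [dist_eq_norm]
    linarith [h c hc d hd hcd]
  have hsub : ⋃ c ∈ s, Metric.ball c (ε / 2) ⊆ Metric.ball (0 : E) (1 + ε / 2) := by
    refine Set.iUnion₂_subset fun x hx => Metric.ball_subset_ball' ?_
    rw [dist_zero_right]
    linarith [hs x hx]
  have hvol : (s.card : ENNReal) * ENNReal.ofReal ((ε / 2) ^ Module.finrank ℝ E)
        * μ (Metric.ball 0 1) ≤
      ENNReal.ofReal ((1 + ε / 2) ^ Module.finrank ℝ E) * μ (Metric.ball 0 1) := by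
    have := measure_mono (μ := μ) hsub
    rw [measure_biUnion_finset hdisj fun c _ => measurableSet_ball] at this
    simp only [μ.addHaar_ball_of_pos _ hδ, μ.addHaar_ball_of_pos _ hρ, Finset.sum_const,
      nsmul_eq_mul, ← mul_assoc] at this
    exact this
  have hJ := (ENNReal.mul_le_mul_iff_left (Metric.measure_ball_pos μ _ zero_lt_one).ne'
    measure_ball_lt_top.ne).1 hvol
  have hK := ENNReal.toReal_le_of_le_ofReal (pow_nonneg hρ.le _) hJ
  rw [ENNReal.toReal_mul, ENNReal.toReal_natCast, ENNReal.toReal_ofReal (by positivity),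
    ← le_div_iff₀ (by positivity), ← div_pow] at hK
  rwa [show 1 + 2 / ε = (1 + ε / 2) / (ε / 2) by field_simp; ring]

/-- The unit sphere of a finite-dimensional space has an `ε`-net with at most
`(1 + 2 / ε) ^ dim` points. -/
theorem exists_finset_net_sphere (E : Type*) [NormedAddCommGroup E] [NormedSpace ℝ E]
    [FiniteDimensional ℝ E] {ε : ℝ} (hε : 0 < ε) :
    ∃ s : Finset E, (s.card : ℝ) ≤ (1 + 2 / ε) ^ Module.finrank ℝ E ∧ (∀ u ∈ s, ‖u‖ = 1) ∧
      ∀ v : E, ‖v‖ = 1 → ∃ u ∈ s, ‖v - u‖ ≤ ε := by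
  classical
  let Q : Finset E → Prop := fun s =>
    (∀ c ∈ s, ‖c‖ = 1) ∧ ∀ c ∈ s, ∀ d ∈ s, c ≠ d → ε ≤ ‖c - d‖
  have hcard : ∀ s, Q s → (s.card : ℝ) ≤ (1 + 2 / ε) ^ Module.finrank ℝ E := fun s hs =>
    card_le_of_separated_of_norm_le_one hε s (fun c hc => (hs.1 c hc).le) hs.2
  -- Separated sets have bounded size, so one of maximal size exists; a point farther than ε from
  -- all of it could be added.
  have hbdd : BddAbove {m : ℕ | ∃ s, Q s ∧ s.card = m} := by
    refine ⟨⌊(1 + 2 / ε) ^ Module.finrank ℝ E⌋₊, ?_⟩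
    rintro m ⟨s, hs, rfl⟩
    exact Nat.le_floor (hcard s hs)
  obtain ⟨s, hs, hmax⟩ := Nat.sSup_mem (s := {m : ℕ | ∃ s, Q s ∧ s.card = m})
    ⟨0, ∅, by simp [Q], rfl⟩ hbdd
  refine ⟨s, hcard s hs, hs.1, fun v hv => ?_⟩
  by_contra! hc
  have hvs : v ∉ s := fun hvs => by
    have := hc v hvs
    simp at this
    linarith
  have hQ : Q (insert v s) := by
    refine ⟨fun c hc' => ?_, fun c hc' d hd hcd => ?_⟩
    · rcases Finset.mem_insert.1 hc' with rfl | h'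
      exacts [hv, hs.1 c h']
    · rcases Finset.mem_insert.1 hc' with rfl | h1 <;> rcases Finset.mem_insert.1 hd with rfl | h2
      · exact absurd rfl hcd
      · exact (hc d h2).le
      · rw [norm_sub_rev]; exact (hc c h1).le
      · exact hs.2 c h1 d h2 hcd
  have := le_csSup hbdd ⟨insert v s, hQ, rfl⟩
  rw [← hmax, Finset.card_insert_of_notMem hvs] at this
  omega

/-- Two-sided bounds for a linear map on a fine net of the sphere extend to the whole space. -/
theorem norm_bounds_of_net {E F : Type*} [NormedAddCommGroup E] [NormedSpace ℝ E]
    [FiniteDimensional ℝ E] [NormedAddCommGroup F] [NormedSpace ℝ F] (f : E →ₗ[ℝ] F)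
    {D : ℝ} (hD : 1 ≤ D) (s : Finset E)
    (hnet : ∀ v : E, ‖v‖ = 1 → ∃ u ∈ s, ‖v - u‖ ≤ 1 / (8 * D))
    (hlow : ∀ u ∈ s, 3 / 4 ≤ ‖f u‖) (hupp : ∀ u ∈ s, ‖f u‖ ≤ D) (v : E) :
    1 / 2 * ‖v‖ ≤ ‖f v‖ ∧ ‖f v‖ ≤ 2 * D * ‖v‖ := by
  set g : E →L[ℝ] F := LinearMap.toContinuousLinearMap f with hg
  have hgf : ∀ v, g v = f v := fun v => rfl
  have hε : 1 / (8 * D) ≤ 1 / 2 := by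
    apply one_div_le_one_div_of_le <;> linarith
  have hεD : D * (1 / (8 * D)) = 1 / 8 := by field_simp
  have hε0 : 0 ≤ 1 / (8 * D) := by positivity
  have hunit : ∀ v : E, v ≠ 0 → ‖‖v‖⁻¹ • v‖ = 1 := fun v hv => norm_smul_inv_norm hv
  have hscale : ∀ v : E, v ≠ 0 → ‖f v‖ = ‖v‖ * ‖f (‖v‖⁻¹ • v)‖ := fun v hv => by
    rw [map_smul, norm_smul, norm_inv, norm_norm, mul_inv_cancel_left₀ (norm_ne_zero_iff.2 hv)]
  -- The operator norm is finite, so this self-referential bound can be solved for it.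
  have hS : ‖g‖ ≤ D + ‖g‖ * (1 / (8 * D)) := by
    refine g.opNorm_le_bound (by positivity) fun v => ?_
    rcases eq_or_ne v 0 with rfl | hv
    · simp
    rw [hgf, hscale v hv, mul_comm]
    refine mul_le_mul_of_nonneg_right ?_ (norm_nonneg _)
    obtain ⟨u, hu, huv⟩ := hnet _ (hunit v hv)
    have h1 : f (‖v‖⁻¹ • v) = f u + g (‖v‖⁻¹ • v - u) := by rw [hgf, ← map_add]; simp
    rw [h1]
    refine (norm_add_le _ _).trans (add_le_add (hupp u hu) ((g.le_opNorm _).trans ?_))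
    exact mul_le_mul_of_nonneg_left huv (norm_nonneg _)
  have hS2 : ‖g‖ ≤ 2 * D := by nlinarith [norm_nonneg g]
  refine ⟨?_, (g.le_opNorm v).trans (mul_le_mul_of_nonneg_right hS2 (norm_nonneg _))⟩
  rcases eq_or_ne v 0 with rfl | hv
  · simp
  rw [hscale v hv, mul_comm]
  refine mul_le_mul_of_nonneg_left ?_ (norm_nonneg _)
  obtain ⟨u, hu, huv⟩ := hnet _ (hunit v hv)
  have h1 : f u = f (‖v‖⁻¹ • v) - g (‖v‖⁻¹ • v - u) := by rw [hgf, ← map_sub]; simp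
  have h2 := hlow u hu
  rw [h1] at h2
  have h3 := norm_sub_le (f (‖v‖⁻¹ • v)) (g (‖v‖⁻¹ • v - u))
  -- The mesh 1/(8D) makes this error at most 1/4, and 3/4 - 1/4 = 1/2.
  have h4 : ‖g (‖v‖⁻¹ • v - u)‖ ≤ 2 * D * (1 / (8 * D)) :=
    (g.le_opNorm _).trans (mul_le_mul hS2 huv (norm_nonneg _) (by linarith))
  nlinarith

/-! ### Block decomposition into sparse vectors. -/

/-- Any finset contains, for each admissible `k`, a subset of `k` largest elements with respect
to `f`. -/
theorem exists_subset_card_eq_forall_le {ι : Type*} [DecidableEq ι] (s : Finset ι) (f : ι → ℝ)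
    {k : ℕ} (hk : k ≤ s.card) :
    ∃ T ⊆ s, T.card = k ∧ ∀ i ∈ T, ∀ j ∈ s \ T, f j ≤ f i := by
  induction k with
  | zero => exact ⟨∅, by simp, rfl, by simp⟩
  | succ k ih =>
    obtain ⟨T, hTs, hT, hle⟩ := ih (by omega)
    have hne : (s \ T).Nonempty := by
      rw [← Finset.card_pos, Finset.card_sdiff_of_subset hTs]
      omega
    obtain ⟨m, hm, hmax⟩ := Finset.exists_max_image (s \ T) f hne
    rw [Finset.mem_sdiff] at hm
    refine ⟨insert m T, Finset.insert_subset hm.1 hTs, ?_, fun i hi j hj => ?_⟩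
    · rw [Finset.card_insert_of_notMem hm.2, hT]
    · have hj' : j ∈ s \ T := by
        simp only [Finset.mem_sdiff, Finset.mem_insert, not_or] at hj ⊢
        exact ⟨hj.1, hj.2.2⟩
      rcases Finset.mem_insert.1 hi with rfl | hi
      · exact hmax j hj'
      · exact hle i hi j hj'

/-- The submodule of vectors supported in `T`. -/
def supportedIn {p : ℕ} (T : Finset (Fin p)) : Submodule ℝ (EuclideanSpace ℝ (Fin p)) where
  carrier := {v | ∀ i ∉ T, v i = 0}
  add_mem' := fun {a b} ha hb i hi => by simp [ha i hi, hb i hi]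
  zero_mem' := fun i _ => rfl
  smul_mem' := fun c a ha i hi => by simp [ha i hi]

theorem finrank_supportedIn_le {p : ℕ} (T : Finset (Fin p)) :
    Module.finrank ℝ (supportedIn T) ≤ T.card := by
  let φ : supportedIn T →ₗ[ℝ] (T → ℝ) :=
    { toFun := fun v i => v.1 i
      map_add' := fun _ _ => rfl
      map_smul' := fun _ _ => rfl }
  have hφ : Function.Injective φ := by
    intro a b hab
    ext i
    by_cases hi : i ∈ T
    · exact congrFun hab ⟨i, hi⟩
    · rw [a.2 i hi, b.2 i hi]
  simpa using LinearMap.finrank_le_finrank_of_injective hφ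

theorem l1Norm_nonneg {p : ℕ} (v : EuclideanSpace ℝ (Fin p)) : 0 ≤ l1Norm v :=
  Finset.sum_nonneg fun _ _ => abs_nonneg _

theorem l1Norm_sub_le {p : ℕ} (v w : EuclideanSpace ℝ (Fin p)) :
    l1Norm (v - w) ≤ l1Norm v + l1Norm w := by
  simp only [l1Norm, ← Finset.sum_add_distrib]
  exact Finset.sum_le_sum fun i _ => abs_sub _ _

theorem norm_le_l1Norm {p : ℕ} (v : EuclideanSpace ℝ (Fin p)) : ‖v‖ ≤ l1Norm v := by
  refine abs_le_of_sq_le_sq' ?_ (l1Norm_nonneg v) |>.2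
  rw [EuclideanSpace.real_norm_sq_eq, l1Norm]
  simpa using Finset.sum_sq_le_sq_sum_of_nonneg (s := Finset.univ) (f := fun i => |v i|)
    (fun i _ => abs_nonneg _)

/-- Splitting off the `k` largest entries of a vector. -/
theorem exists_sparse_add {p k : ℕ} (hk : 0 < k) (hkp : k ≤ p) (h : EuclideanSpace ℝ (Fin p)) :
    ∃ (T : Finset (Fin p)) (u w : EuclideanSpace ℝ (Fin p)) (M : ℝ), T.card = k ∧
      h = u + w ∧ u ∈ supportedIn T ∧ 0 ≤ M ∧ (∀ i, |w i| ≤ M) ∧ (∀ i, |u i| ≤ |h i|) ∧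
      k * M + l1Norm w ≤ l1Norm h ∧
      (w = 0 ∨ (Finset.univ.filter fun i => w i ≠ 0).card <
        (Finset.univ.filter fun i => h i ≠ 0).card) := by
  obtain ⟨T, -, hT, hle⟩ := exists_subset_card_eq_forall_le (Finset.univ : Finset (Fin p))
    (fun i => |h i|) (k := k) (by simpa using hkp)
  have hle' : ∀ i ∈ T, ∀ j ∉ T, |h j| ≤ |h i| := fun i hi j hj => hle i hi j (by simpa using hj)
  -- The least modulus on T serves as M: it dominates every entry off T, and kM is at most the ℓ₁
  -- mass on T.
  obtain ⟨m, hm, hmin⟩ := Finset.exists_min_image T (fun i => |h i|)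
    (Finset.card_pos.1 (by omega))
  refine ⟨T, WithLp.toLp 2 fun i => if i ∈ T then h i else 0,
    WithLp.toLp 2 fun i => if i ∈ T then 0 else h i, |h m|, hT, ?_, ?_, abs_nonneg _, ?_, ?_, ?_, ?_⟩
  · ext i
    by_cases hi : i ∈ T <;> simp [hi]
  · intro i hi
    simp [hi]
  · intro i
    by_cases hi : i ∈ T
    · simp [hi]
    · simpa [hi] using hle' m hm i hi
  · intro i
    by_cases hi : i ∈ T <;> simp [hi]
  · have h1 : (k : ℝ) * |h m| ≤ ∑ i, if i ∈ T then |h i| else 0 := by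
      rw [Finset.sum_ite_mem, Finset.univ_inter, ← hT, ← nsmul_eq_mul]
      exact Finset.card_nsmul_le_sum _ _ _ hmin
    refine (add_le_add_left h1 _).trans_eq ?_
    simp only [l1Norm, ← Finset.sum_add_distrib]
    refine Finset.sum_congr rfl fun i _ => ?_
    by_cases hi : i ∈ T <;> simp [hi]
  -- A nonzero entry off T forces T to carry nonzero entries, so the support shrinks strictly; this
  -- drives the induction in `le_of_forall_sparse_le`.
  · by_cases hw : ∃ j ∉ T, h j ≠ 0
    · right
      obtain ⟨j, hj, hj0⟩ := hw
      refine Finset.card_lt_card ⟨fun i hi => ?_, fun hsub => ?_⟩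
      · simp only [Finset.mem_filter, Finset.mem_univ, true_and] at hi ⊢
        by_cases hiT : i ∈ T
        · simp [hiT] at hi
        · simpa [hiT] using hi
      · have hm0 : h m ≠ 0 := abs_pos.1 ((abs_pos.2 hj0).trans_le (hle' m hm j hj))
        have := hsub (Finset.mem_filter.2 ⟨Finset.mem_univ m, hm0⟩)
        simp [hm] at this
    · left
      push Not at hw
      ext i
      by_cases hi : i ∈ T
      · simp [hi]
      · simp [hi, hw i hi]

theorem norm_le_sqrt_mul_of_mem_supportedIn {p k : ℕ} {T : Finset (Fin p)} (hT : T.card = k)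
    {u : EuclideanSpace ℝ (Fin p)} (hu : u ∈ supportedIn T) {M : ℝ} (hM : 0 ≤ M)
    (huM : ∀ i, |u i| ≤ M) : ‖u‖ ≤ √k * M := by
  rw [EuclideanSpace.norm_eq]
  refine Real.sqrt_le_iff.2 ⟨by positivity, ?_⟩
  rw [mul_pow, Real.sq_sqrt (Nat.cast_nonneg k), ← hT, ← nsmul_eq_mul,
    ← Finset.sum_subset (Finset.subset_univ T) fun i _ hi => by simp [hu i hi]]
  refine Finset.sum_le_card_nsmul _ _ _ fun i _ => ?_
  rw [Real.norm_eq_abs]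
  exact pow_le_pow_left₀ (abs_nonneg _) (huM i) 2

/-- A subadditive functional controlled by the `ℓ₂` norm on `k`-sparse vectors is controlled by a
mixture of the `ℓ_∞` and `ℓ₁` norms on all vectors. -/
theorem le_of_forall_sparse_le {p k : ℕ} (hk : 0 < k) (hkp : k ≤ p)
    (N : EuclideanSpace ℝ (Fin p) → ℝ) (hadd : ∀ u v, N (u + v) ≤ N u + N v) {C : ℝ} (hC : 0 ≤ C)
    (hN : ∀ T : Finset (Fin p), T.card = k → ∀ u ∈ supportedIn T, N u ≤ C * ‖u‖)
    (v : EuclideanSpace ℝ (Fin p)) {M : ℝ} (hM : 0 ≤ M) (hv : ∀ i, |v i| ≤ M) :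
    N v ≤ C * (√k * M + l1Norm v / √k) := by
  obtain ⟨m, hm⟩ : ∃ m, (Finset.univ.filter fun i => v i ≠ 0).card = m := ⟨_, rfl⟩
  induction m using Nat.strong_induction_on generalizing v M with
  | _ m ih =>
    obtain ⟨T, u, w, M', hT, hvuw, hu, hM', hwM', huv, hl1, hw⟩ := exists_sparse_add hk hkp v
    have hsk : 0 < √(k : ℝ) := Real.sqrt_pos.2 (by exact_mod_cast hk)
    have hNu : N u ≤ C * (√k * M) := (hN T hT u hu).trans <| mul_le_mul_of_nonneg_left
      (norm_le_sqrt_mul_of_mem_supportedIn hT hu hM fun i => (huv i).trans (hv i)) hC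
    -- The ℓ₁ mass of the removed block pays for the sup-norm term of the remainder, so the bounds
    -- telescope.
    have hkey : √k * M' + l1Norm w / √k ≤ l1Norm v / √k := by
      rw [le_div_iff₀ hsk, add_mul, div_mul_cancel₀ _ hsk.ne']
      have : √(k : ℝ) * √k = k := Real.mul_self_sqrt (Nat.cast_nonneg k)
      nlinarith
    have hNw : N w ≤ C * (√k * M' + l1Norm w / √k) := by
      rcases hw with rfl | hw
      · refine (hN T hT 0 (Submodule.zero_mem _)).trans ?_
        rw [norm_zero, mul_zero]
        have := l1Norm_nonneg (0 : EuclideanSpace ℝ (Fin p))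
        positivity
      · exact ih _ (hm ▸ hw) w hM' hwM' rfl
    calc N v ≤ N u + N w := hvuw ▸ hadd u w
      _ ≤ C * (√k * M) + C * (l1Norm v / √k) :=
        add_le_add hNu (hNw.trans (mul_le_mul_of_nonneg_left hkey hC))
      _ = _ := by ring

/-- A restricted isometry bound on `k`-sparse vectors controls the `ℓ₂` norm of every vector by
the norm of its image and its `ℓ₁` norm. -/
theorem norm_le_of_restricted_isometry {p k : ℕ} (hk : 0 < k) (hkp : k ≤ p) {F : Type*}
    [NormedAddCommGroup F] [NormedSpace ℝ F] (f : EuclideanSpace ℝ (Fin p) →ₗ[ℝ] F) {D : ℝ}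
    (hD : 0 ≤ D)
    (hlow : ∀ T : Finset (Fin p), T.card = k → ∀ u ∈ supportedIn T, 1 / 2 * ‖u‖ ≤ ‖f u‖)
    (hupp : ∀ T : Finset (Fin p), T.card = k → ∀ u ∈ supportedIn T, ‖f u‖ ≤ D * ‖u‖)
    (h : EuclideanSpace ℝ (Fin p)) :
    ‖h‖ ≤ 2 * ‖f h‖ + (2 * D + 1) * (l1Norm h / √k) := by
  obtain ⟨T, u, w, M, hT, huw, hu, hM, hwM, -, hl1, -⟩ := exists_sparse_add hk hkp h
  have hsk : 0 < √(k : ℝ) := Real.sqrt_pos.2 (by exact_mod_cast hk)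
  have hkey : √k * M + l1Norm w / √k ≤ l1Norm h / √k := by
    rw [le_div_iff₀ hsk, add_mul, div_mul_cancel₀ _ hsk.ne']
    have : √(k : ℝ) * √k = k := Real.mul_self_sqrt (Nat.cast_nonneg k)
    nlinarith
  -- The block lemma is used twice, for the norm itself and for the norm of the image.
  have h1 : ‖w‖ ≤ 1 * (√k * M + l1Norm w / √k) :=
    le_of_forall_sparse_le hk hkp (fun v => ‖v‖) norm_add_le zero_le_one
      (fun _ _ u _ => (one_mul ‖u‖).ge) w hM hwM
  have h2 : ‖f w‖ ≤ D * (√k * M + l1Norm w / √k) :=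
    le_of_forall_sparse_le hk hkp (fun v => ‖f v‖)
      (fun u v => by rw [map_add]; exact norm_add_le _ _) hD hupp w hM hwM
  have h3 := hlow T hT u hu
  have h4 : ‖f u‖ ≤ ‖f h‖ + ‖f w‖ := by
    have : f u = f h - f w := by rw [huw, map_add]; abel
    rw [this]; exact norm_sub_le _ _
  have h5 : ‖h‖ ≤ ‖u‖ + ‖w‖ := huw ▸ norm_add_le u w
  have h6 := mul_le_mul_of_nonneg_left hkey hD
  nlinarith

/-! ### Exponential moments of sub-Gaussian variables and their squares. -/

theorem ProbabilityTheory.HasSubgaussianMGF.of_le {Ω : Type*} [MeasurableSpace Ω] {μ : Measure Ω}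
    {X : Ω → ℝ} {c d : ℝ≥0} (h : HasSubgaussianMGF X c μ) (hcd : c ≤ d) :
    HasSubgaussianMGF X d μ where
  integrable_exp_mul := h.integrable_exp_mul
  mgf_le t := (h.mgf_le t).trans <| Real.exp_le_exp.2 <| by gcongr

/-- (1 + u + u²/2)(1 - u + u²/2) = 1 + u⁴/4 ≥ 1, and the first factor is at most exp u. -/
theorem exp_neg_le_quadratic {u : ℝ} (hu : 0 ≤ u) : Real.exp (-u) ≤ 1 - u + u ^ 2 / 2 := by
  have h1 := Real.quadratic_le_exp_of_nonneg hu
  have h2 : 0 < 1 - u + u ^ 2 / 2 := by nlinarith [sq_nonneg (u - 1)]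
  rw [Real.exp_neg, inv_le_comm₀ (Real.exp_pos u) h2]
  refine le_trans ?_ h1
  rw [inv_le_iff_one_le_mul₀ h2]
  nlinarith [sq_nonneg (u ^ 2)]

/-- Reduces the fourth moment to the moment generating function at ±1. -/
theorem pow_four_le_exp_add_exp (y : ℝ) : y ^ 4 ≤ 24 * (Real.exp y + Real.exp (-y)) := by
  have h := Real.pow_div_factorial_le_exp |y| (abs_nonneg y) 4
  rw [div_le_iff₀ (by positivity), (by decide : Even 4).pow_abs] at h
  have h24 : ((Nat.factorial 4 : ℕ) : ℝ) = 24 := by norm_num [Nat.factorial]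
  rw [h24] at h
  have h' : Real.exp |y| ≤ Real.exp y + Real.exp (-y) := by
    rcases abs_cases y with ⟨h, -⟩ | ⟨h, -⟩ <;> rw [h] <;>
      linarith [Real.exp_pos y, Real.exp_pos (-y)]
  linarith

theorem ProbabilityTheory.iIndepFun.integrable_fun_prod {Ω ι : Type*} [Fintype ι]
    [MeasurableSpace Ω] {μ : Measure Ω} {X : ι → Ω → ℝ} (hind : iIndepFun X μ)
    (hint : ∀ i, Integrable (X i) μ) : Integrable (fun ω => ∏ i, X i ω) μ := by
  have := hind.isProbabilityMeasure
  have hm : ∀ i, AEMeasurable (X i) μ := fun i => (hint i).aemeasurable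
  have := fun i => Measure.isProbabilityMeasure_map (hm i)
  have h : Integrable (fun x : ι → ℝ => ∏ i, x i) (Measure.pi fun i => μ.map (X i)) :=
    Integrable.fintype_prod (f := fun _ x => x) fun i =>
      (integrable_map_measure (by fun_prop) (hm i)).2 (hint i)
  rw [← hind.map_fun_eq_pi_map hm] at h
  exact h.comp_aemeasurable (aemeasurable_pi_iff.2 hm)

theorem ProbabilityTheory.HasSubgaussianMGF.integrable_sq {Ω : Type*} [MeasurableSpace Ω]
    {μ : Measure Ω} {Y : Ω → ℝ} {K : ℝ≥0} (hY : HasSubgaussianMGF Y K μ) :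
    Integrable (fun ω => Y ω ^ 2) μ :=
  (by simpa using hY.memLp 2 : MemLp Y 2 μ).integrable_sq

section SingleVariable

variable {Ω : Type*} [MeasurableSpace Ω] {μ : Measure Ω} [IsProbabilityMeasure μ] {Y : Ω → ℝ}
  {K : ℝ≥0}

theorem integrable_exp_neg_mul_sq_comp (hY : AEMeasurable Y μ) {t : ℝ} (ht : t ≤ 0) :
    Integrable (fun ω => Real.exp (t * Y ω ^ 2)) μ := by
  refine Integrable.of_bound (C := 1) (by fun_prop) (ae_of_all _ fun ω => ?_)
  rw [Real.norm_eq_abs, Real.abs_exp, Real.exp_le_one_iff]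
  exact mul_nonpos_of_nonpos_of_nonneg ht (sq_nonneg _)

/-- The Laplace transform of the square of a sub-Gaussian variable with unit second moment. -/
theorem ProbabilityTheory.HasSubgaussianMGF.mgf_sq_neg_le (hY : HasSubgaussianMGF Y K μ)
    (h1 : ∫ ω, Y ω ^ 2 ∂μ = 1) {l : ℝ} (hl : 0 ≤ l) :
    mgf (fun ω => Y ω ^ 2) μ (-l) ≤ Real.exp (-l + 24 * Real.exp (K / 2) * l ^ 2) := by
  have he1 : Integrable (fun ω => Real.exp (Y ω)) μ := by
    simpa using hY.integrable_exp_mul 1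
  have he2 : Integrable (fun ω => Real.exp (-Y ω)) μ := by
    simpa using hY.integrable_exp_mul (-1)
  have hm1 : ∫ ω, Real.exp (Y ω) ∂μ ≤ Real.exp (K / 2) := by
    simpa [mgf] using hY.mgf_le 1
  have hm2 : ∫ ω, Real.exp (-Y ω) ∂μ ≤ Real.exp (K / 2) := by
    simpa [mgf] using hY.mgf_le (-1)
  have hsq := hY.integrable_sq
  -- The second-order term l²Y⁴/2 meets the fourth-power bound, whence 12 = 24/2.
  have hpt : ∀ ω, Real.exp (-l * Y ω ^ 2) ≤
      1 - l * Y ω ^ 2 + l ^ 2 * 12 * (Real.exp (Y ω) + Real.exp (-Y ω)) := fun ω => by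
    have h := exp_neg_le_quadratic (mul_nonneg hl (sq_nonneg (Y ω)))
    have h4 := mul_le_mul_of_nonneg_left (pow_four_le_exp_add_exp (Y ω)) (sq_nonneg l)
    rw [neg_mul]
    nlinarith
  calc mgf (fun ω => Y ω ^ 2) μ (-l)
      ≤ ∫ ω, (1 - l * Y ω ^ 2 + l ^ 2 * 12 * (Real.exp (Y ω) + Real.exp (-Y ω))) ∂μ :=
        integral_mono (integrable_exp_neg_mul_sq_comp hY.aemeasurable (by linarith))
          (((integrable_const _).sub (hsq.const_mul l)).add ((he1.add he2).const_mul _)) hpt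
    _ = 1 - l + l ^ 2 * 12 * (∫ ω, Real.exp (Y ω) ∂μ + ∫ ω, Real.exp (-Y ω) ∂μ) := by
        have ha := integral_add ((integrable_const (1 : ℝ)).sub (hsq.const_mul l))
          ((he1.add he2).const_mul (l ^ 2 * 12))
        have hb := integral_sub (integrable_const (1 : ℝ)) (hsq.const_mul l)
        have hc := integral_add he1 he2
        simp only [Pi.add_apply, Pi.sub_apply, integral_const_mul] at ha hb hc
        rw [ha, hb, hc, h1]
        simp
    _ ≤ 1 - l + l ^ 2 * 12 * (Real.exp (K / 2) + Real.exp (K / 2)) := by gcongr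
    _ = (-l + 24 * Real.exp (K / 2) * l ^ 2) + 1 := by ring
    _ ≤ _ := Real.add_one_le_exp _

/-- The square of a sub-Gaussian variable is dominated, in exponential moments, by the square of
a Gaussian variable. -/
theorem ProbabilityTheory.HasSubgaussianMGF.lintegral_exp_sq_le (hY : HasSubgaussianMGF Y K μ)
    (hK : 0 < K) {C : ℝ} (hC : 0 ≤ C) :
    ∫⁻ ω, ENNReal.ofReal (Real.exp (C / K * Y ω ^ 2)) ∂μ ≤
      ∫⁻ g, ENNReal.ofReal (Real.exp (C * g ^ 2)) ∂(gaussianReal 0 1) := by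
  have hK' : (0 : ℝ) < K := by exact_mod_cast hK
  -- Gaussian linearization: exp(s²Y²/2) is the mean of exp(sYg) over a standard Gaussian g. After
  -- Tonelli, the mean over Y is at most exp(Ks²g²/2) = exp(Cg²).
  set s : ℝ := √(2 * C / K) with hs
  have hs2 : s ^ 2 = 2 * C / K := Real.sq_sqrt (by positivity)
  have hgauss : ∀ ω, ENNReal.ofReal (Real.exp (C / K * Y ω ^ 2)) =
      ∫⁻ g, ENNReal.ofReal (Real.exp (s * Y ω * g)) ∂(gaussianReal 0 1) := fun ω => by
    rw [← ofReal_integral_eq_lintegral_ofReal (integrable_exp_mul_gaussianReal _)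
      (ae_of_all _ fun _ => (Real.exp_pos _).le)]
    congr 1
    have := mgf_gaussianReal (p := gaussianReal 0 1) (X := id) (μ := 0) (v := 1) (by simp)
      (s * Y ω)
    simp only [mgf, id] at this
    rw [this, mul_pow, hs2]
    congr 1
    simp
    ring
  calc ∫⁻ ω, ENNReal.ofReal (Real.exp (C / K * Y ω ^ 2)) ∂μ
      = ∫⁻ ω, ∫⁻ g, ENNReal.ofReal (Real.exp (s * Y ω * g)) ∂(gaussianReal 0 1) ∂μ :=
        lintegral_congr hgauss
    _ = ∫⁻ g, ∫⁻ ω, ENNReal.ofReal (Real.exp (s * Y ω * g)) ∂μ ∂(gaussianReal 0 1) := by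
        refine lintegral_lintegral_swap ?_
        have hfst : AEMeasurable (fun z : Ω × ℝ => Y z.1) (μ.prod (gaussianReal 0 1)) :=
          hY.aemeasurable.comp_fst
        exact (((hfst.const_mul s).mul measurable_snd.aemeasurable).exp).ennreal_ofReal
    _ ≤ _ := by
        refine lintegral_mono fun g => ?_
        have hint := hY.integrable_exp_mul (s * g)
        have heq : ∀ ω, s * Y ω * g = s * g * Y ω := fun ω => by ring
        simp only [heq]
        rw [← ofReal_integral_eq_lintegral_ofReal hint (ae_of_all _ fun _ => (Real.exp_pos _).le)]
        refine ENNReal.ofReal_le_ofReal ((hY.mgf_le (s * g)).trans_eq ?_)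
        rw [mul_pow, hs2]
        congr 1
        field_simp

end SingleVariable

/-! ### Chernoff bounds for sums of squares. -/

section IndependentSum

variable {Ω : Type*} [MeasurableSpace Ω] {μ : Measure Ω} [IsProbabilityMeasure μ] {n : ℕ}
  {Y : Fin n → Ω → ℝ} {K : ℝ≥0}

/-- Lower tail of a sum of squares of independent sub-Gaussian variables. -/
theorem measure_sum_sq_le_le (hind : iIndepFun Y μ) (hY : ∀ i, HasSubgaussianMGF (Y i) K μ)
    (h1 : ∀ i, ∫ ω, Y i ω ^ 2 ∂μ = 1) :
    μ.real {ω | ∑ i, Y i ω ^ 2 ≤ 9 / 16 * n} ≤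
      Real.exp (-(49 / (24576 * Real.exp (K / 2))) * n) := by
  set M : ℝ := 24 * Real.exp (K / 2) with hM
  have hM0 : 0 < M := by positivity
  -- Minimizes the exponent per summand, (9/16)l - l + Ml², with value -49/(1024M).
  set l : ℝ := 7 / (32 * M) with hl
  have hl0 : 0 ≤ l := by positivity
  have hm : ∀ i, AEMeasurable (fun ω => Y i ω ^ 2) μ := fun i => (hY i).aemeasurable.pow_const 2
  have hind2 : iIndepFun (fun i ω => Y i ω ^ 2) μ :=
    hind.comp (fun _ x => x ^ 2) fun _ => by fun_prop
  have hint : Integrable (fun ω => Real.exp (-l * ∑ i, Y i ω ^ 2)) μ := by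
    refine Integrable.of_bound (C := 1) ?_ (ae_of_all _ fun ω => ?_)
    · have := fun i => (hY i).aemeasurable
      fun_prop
    · rw [Real.norm_eq_abs, Real.abs_exp, Real.exp_le_one_iff]
      exact mul_nonpos_of_nonpos_of_nonneg (by linarith)
        (Finset.sum_nonneg fun i _ => sq_nonneg _)
  have h := measure_le_le_exp_mul_mgf (μ := μ) (X := fun ω => ∑ i, Y i ω ^ 2) (9 / 16 * n)
    (neg_nonpos.2 hl0) hint
  have hmgf := hind2.mgf_sum₀ (t := -l) hm Finset.univ
  have hsum : (∑ i, fun ω => Y i ω ^ 2) = fun ω => ∑ i, Y i ω ^ 2 := by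
    ext ω; simp
  rw [hsum] at hmgf
  refine h.trans ?_
  rw [hmgf]
  calc Real.exp (- -l * (9 / 16 * n)) * ∏ i, mgf (fun ω => Y i ω ^ 2) μ (-l)
      ≤ Real.exp (- -l * (9 / 16 * n)) * ∏ _i : Fin n, Real.exp (-l + M * l ^ 2) := by
        gcongr with i
        · exact fun _ _ => mgf_nonneg
        · exact (hY i).mgf_sq_neg_le (h1 i) hl0
    _ = _ := by
        rw [Finset.prod_const, Finset.card_univ, Fintype.card_fin, ← Real.exp_nat_mul,
          ← Real.exp_add, show 49 / (24576 * Real.exp (K / 2)) = 49 / (1024 * M) by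
            rw [hM]; ring]
        congr 1
        rw [hl]
        field_simp
        ring

/-- Upper tail of a sum of squares of independent variables with a common bound on an
exponential moment of the square. -/
theorem measure_sum_sq_ge_le (hind : iIndepFun Y μ) (hYm : ∀ i, AEMeasurable (Y i) μ)
    {l B : ℝ} (hl : 0 < l) (hB : 0 < B) (hint : ∀ i, Integrable (fun ω => Real.exp (l * Y i ω ^ 2)) μ)
    (hmgf : ∀ i, mgf (fun ω => Y i ω ^ 2) μ l ≤ B) :
    μ.real {ω | (1 + Real.log B) / l * n ≤ ∑ i, Y i ω ^ 2} ≤ Real.exp (-n) := by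
  have hm : ∀ i, AEMeasurable (fun ω => Y i ω ^ 2) μ := fun i => (hYm i).pow_const 2
  have hind2 : iIndepFun (fun i ω => Y i ω ^ 2) μ :=
    hind.comp (fun _ x => x ^ 2) fun _ => by fun_prop
  have hsum : (∑ i, fun ω => Y i ω ^ 2) = fun ω => ∑ i, Y i ω ^ 2 := by
    ext ω; simp
  have hint' : Integrable (fun ω => Real.exp (l * ∑ i, Y i ω ^ 2)) μ := by
    simp only [Finset.mul_sum, Real.exp_sum]
    have hind3 : iIndepFun (fun i ω => Real.exp (l * Y i ω ^ 2)) μ :=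
      hind.comp (fun _ x => Real.exp (l * x ^ 2)) fun _ => by fun_prop
    exact hind3.integrable_fun_prod hint
  -- The threshold makes each factor exp(-(1 + log B))·B equal to exp(-1).
  have h := measure_ge_le_exp_mul_mgf (μ := μ) (X := fun ω => ∑ i, Y i ω ^ 2)
    ((1 + Real.log B) / l * n) hl.le hint'
  have hmgf' := hind2.mgf_sum₀ (t := l) hm Finset.univ
  rw [hsum] at hmgf'
  refine h.trans ?_
  rw [hmgf']
  calc Real.exp (-l * ((1 + Real.log B) / l * n)) * ∏ i, mgf (fun ω => Y i ω ^ 2) μ l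
      ≤ Real.exp (-l * ((1 + Real.log B) / l * n)) * ∏ _i : Fin n, B := by
        gcongr with i
        · exact fun _ _ => mgf_nonneg
        · exact hmgf i
    _ = _ := by
        rw [Finset.prod_const, Finset.card_univ, Fintype.card_fin]
        nth_rw 2 [← Real.exp_log hB]
        rw [← Real.exp_nat_mul, ← Real.exp_add]
        congr 1
        field_simp
        ring

end IndependentSum

/-! ### Rows of the random matrix and tails for a fixed vector. -/

/-- The rows of an array of independent random variables are independent. -/
theorem ProbabilityTheory.iIndepFun.rows {Ω ι κ 𝓧 : Type*} [MeasurableSpace Ω]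
    [MeasurableSpace 𝓧] [Countable ι] [Countable κ] {μ : Measure Ω} {X : ι × κ → Ω → 𝓧}
    (hind : iIndepFun X μ) (hX : ∀ q, AEMeasurable (X q) μ) :
    iIndepFun (fun i ω j => X (i, j) ω) μ := by
  have := hind.isProbabilityMeasure
  have := fun q => Measure.isProbabilityMeasure_map (hX q)
  have hrow : ∀ i, AEMeasurable (fun ω j => X (i, j) ω) μ := fun i =>
    aemeasurable_pi_iff.2 fun j => hX (i, j)
  have hall : AEMeasurable (fun ω q => X q ω) μ := aemeasurable_pi_iff.2 hX
  rw [iIndepFun_iff_map_fun_eq_infinitePi_map₀' hrow]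
  -- Independence is a statement about joint laws; currying turns a product measure over pairs into
  -- a product of row laws.
  have h1 : (fun ω i j => X (i, j) ω) =
      MeasurableEquiv.curry ι κ 𝓧 ∘ fun ω q => X q ω := rfl
  rw [h1, ← AEMeasurable.map_map_of_aemeasurable (by fun_prop) hall,
    hind.map_fun_eq_infinitePi_map₀' hX,
    Measure.infinitePi_map_curry (fun i j => μ.map (X (i, j)))]
  congr 1
  ext1 i
  exact ((hind.precomp (Prod.mk_right_injective i)).map_fun_eq_infinitePi_map₀'
    fun j => hX (i, j)).symm

/-- The normalized coordinates of `A v` for a unit vector `v`. -/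
noncomputable def rowForm {Ω : Type*} {n p : ℕ} (A : Ω → Matrix (Fin n) (Fin p) ℝ) (v : EuclideanSpace ℝ (Fin p)) (i : Fin n)
    (ω : Ω) : ℝ :=
  ∑ j, v j * (√(n : ℝ) * A ω i j)

theorem sum_rowForm_sq {Ω : Type*} {n p : ℕ} (A : Ω → Matrix (Fin n) (Fin p) ℝ) (v : EuclideanSpace ℝ (Fin p)) (ω : Ω) :
    ∑ i, rowForm A v i ω ^ 2 = n * ‖(A ω).toEuclideanLin v‖ ^ 2 := by
  rw [EuclideanSpace.real_norm_sq_eq, Finset.mul_sum]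
  refine Finset.sum_congr rfl fun i _ => ?_
  have h : rowForm A v i ω = √(n : ℝ) * (A ω).toEuclideanLin v i := by
    simp only [rowForm, Matrix.toLpLin_apply, Matrix.mulVec, dotProduct, Finset.mul_sum]
    exact Finset.sum_congr rfl fun j _ => by ring
  rw [h, mul_pow, Real.sq_sqrt (Nat.cast_nonneg n)]

section Rows

variable {Ω : Type*} [MeasurableSpace Ω] {P : Measure Ω} {n p : ℕ}

theorem hasLaw_sqrt_mul {G : Measure ℝ} {X : Ω → ℝ} (hn : 0 < n)
    (hX : HasLaw X (G.map fun g => g / √(n : ℝ)) P) : HasLaw (fun ω => √(n : ℝ) * X ω) G P where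
  aemeasurable := hX.aemeasurable.const_mul _
  map_eq := by
    have hsn : √(n : ℝ) ≠ 0 := (Real.sqrt_pos.2 (by exact_mod_cast hn)).ne'
    have h1 : (fun ω => √(n : ℝ) * X ω) = (fun x => √(n : ℝ) * x) ∘ X := rfl
    rw [h1, ← AEMeasurable.map_map_of_aemeasurable (by fun_prop) hX.aemeasurable, hX.map_eq,
      Measure.map_map (by fun_prop) (by fun_prop)]
    have h2 : (fun x => √(n : ℝ) * x) ∘ (fun g => g / √(n : ℝ)) = id := by
      ext x; simp [mul_div_cancel₀ _ hsn]
    rw [h2, Measure.map_id]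

variable {G : Measure ℝ} {A : Ω → Matrix (Fin n) (Fin p) ℝ}

theorem IsIIDScaledSample.iIndepFun_entries (hA : IsIIDScaledSample P G A) :
    iIndepFun (fun (q : Fin n × Fin p) ω => √(n : ℝ) * A ω q.1 q.2) P :=
  hA.indep.comp (fun _ x => √(n : ℝ) * x) fun _ => by fun_prop

theorem IsIIDScaledSample.iIndepFun_rowForm (hn : 0 < n) (hA : IsIIDScaledSample P G A)
    (v : EuclideanSpace ℝ (Fin p)) : iIndepFun (rowForm A v) P :=
  (hA.iIndepFun_entries.rows fun q => (hasLaw_sqrt_mul hn (hA.law q.1 q.2)).aemeasurable).comp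
    (fun _ x => ∑ j, v j * x j) fun _ => by fun_prop

theorem IsIIDScaledSample.hasSubgaussianMGF_entry (hn : 0 < n) (hA : IsIIDScaledSample P G A)
    {K : ℝ≥0} (hK : HasSubgaussianMGF id K G) (i : Fin n) (j : Fin p) :
    HasSubgaussianMGF (fun ω => √(n : ℝ) * A ω i j) K P := by
  have h := hasLaw_sqrt_mul hn (hA.law i j)
  rw [← HasSubgaussianMGF.id_map_iff h.aemeasurable, h.map_eq]
  exact hK

/-- Variance proxies of independent summands add, and ∑ vⱼ²K = K, so the proxy is free of p. -/
theorem IsIIDScaledSample.hasSubgaussianMGF_rowForm (hn : 0 < n) (hA : IsIIDScaledSample P G A)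
    {K : ℝ≥0} (hK : HasSubgaussianMGF id K G) {v : EuclideanSpace ℝ (Fin p)} (hv : ‖v‖ = 1)
    (i : Fin n) : HasSubgaussianMGF (rowForm A v i) K P := by
  have hind : iIndepFun (fun j ω => v j * (√(n : ℝ) * A ω i j)) P :=
    (hA.iIndepFun_entries.precomp (Prod.mk_right_injective i)).comp (fun j x => v j * x)
      fun _ => by fun_prop
  have h := HasSubgaussianMGF.sum_of_iIndepFun (s := Finset.univ) hind fun j _ =>
    (hA.hasSubgaussianMGF_entry hn hK i j).const_mul (v j)
  have hs : ∑ j, (NNReal.mk (v j ^ 2) (sq_nonneg (v j))) * K = K := by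
    rw [← Finset.sum_mul]
    have h1 : ∑ j, (NNReal.mk (v j ^ 2) (sq_nonneg (v j))) = 1 := by
      ext
      rw [NNReal.coe_sum]
      simp only [NNReal.coe_mk, NNReal.coe_one]
      rw [← EuclideanSpace.real_norm_sq_eq, hv, one_pow]
    rw [h1, one_mul]
  exact h.of_le hs.le

/-- The row form is centred, so its second moment is its variance, and independence gives ∑ vⱼ² = 1.
-/
theorem IsIIDScaledSample.integral_rowForm_sq [IsProbabilityMeasure P] (hn : 0 < n) (hG : IsStandardSubGaussian G)
    (hA : IsIIDScaledSample P G A) {v : EuclideanSpace ℝ (Fin p)} (hv : ‖v‖ = 1) (i : Fin n) :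
    ∫ ω, rowForm A v i ω ^ 2 ∂P = 1 := by
  obtain ⟨K, hK⟩ := hG.subGaussian
  have hlaw := fun j => hasLaw_sqrt_mul hn (hA.law i j)
  have hind : iIndepFun (fun j ω => v j * (√(n : ℝ) * A ω i j)) P :=
    (hA.iIndepFun_entries.precomp (Prod.mk_right_injective i)).comp (fun j x => v j * x)
      fun _ => by fun_prop
  have hsub := fun j => (hA.hasSubgaussianMGF_entry hn hK i j).const_mul (v j)
  have hmean : ∀ j, ∫ ω, √(n : ℝ) * A ω i j ∂P = 0 := fun j => by
    rw [(hlaw j).integral_eq, hG.mean_eq_zero]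
  have hvar : ∀ j, variance (fun ω => v j * (√(n : ℝ) * A ω i j)) P = v j ^ 2 := fun j => by
    rw [variance_const_mul, (hlaw j).variance_eq, hG.variance_eq_one, mul_one]
  have hsum : rowForm A v i = ∑ j, fun ω => v j * (√(n : ℝ) * A ω i j) := by
    ext ω; simp [rowForm]
  have hY := hA.hasSubgaussianMGF_rowForm hn hK hv i
  have hEY : ∫ ω, rowForm A v i ω ∂P = 0 := by
    simp only [rowForm]
    rw [integral_finsetSum _ fun j _ => (hsub j).integrable]
    refine Finset.sum_eq_zero fun j _ => ?_
    rw [integral_const_mul, hmean, mul_zero]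
  rw [← variance_of_integral_eq_zero hY.aemeasurable hEY, hsum,
    IndepFun.variance_sum (fun j _ => by simpa using (hsub j).memLp 2)
      fun a _ b _ hab => hind.indepFun hab]
  simp only [hvar]
  rw [← EuclideanSpace.real_norm_sq_eq, hv, one_pow]

end Rows

/-- Tail bounds for the norm of the image of a fixed unit vector under a sub-Gaussian matrix. -/
theorem IsStandardSubGaussian.exists_tail_bounds {G : Measure ℝ} (hG : IsStandardSubGaussian G) :
    ∃ κ D : ℝ, 0 < κ ∧ 1 ≤ D ∧ ∀ {Ω : Type*} [MeasurableSpace Ω] {P : Measure Ω}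
      [IsProbabilityMeasure P] {n p : ℕ} {A : Ω → Matrix (Fin n) (Fin p) ℝ},
      0 < n → IsIIDScaledSample P G A → ∀ v : EuclideanSpace ℝ (Fin p), ‖v‖ = 1 →
        P.real {ω | ‖(A ω).toEuclideanLin v‖ ≤ 3 / 4} ≤ Real.exp (-κ * n) ∧
        P.real {ω | D ≤ ‖(A ω).toEuclideanLin v‖} ≤ Real.exp (-κ * n) := by
  obtain ⟨K₀, hK₀⟩ := hG.subGaussian
  -- `lintegral_exp_sq_le` divides by the proxy, so it is enlarged to be positive.
  obtain ⟨K, hK0, hK⟩ : ∃ K : ℝ≥0, 0 < K ∧ HasSubgaussianMGF id K G :=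
    ⟨K₀ + 1, by positivity, hK₀.of_le (by simp)⟩
  obtain ⟨C, hC, hCint⟩ := IsGaussian.exists_integrable_exp_sq (gaussianReal 0 1)
  simp only [Real.norm_eq_abs, sq_abs] at hCint
  set B : ℝ := ∫ g, Real.exp (C * g ^ 2) ∂(gaussianReal 0 1) with hB
  have hB1 : 1 ≤ B := by
    have := integral_mono (integrable_const (1 : ℝ)) hCint fun g =>
      Real.one_le_exp (mul_nonneg hC.le (sq_nonneg g))
    simpa using this
  have hK' : (0 : ℝ) < K := by exact_mod_cast hK0
  set l : ℝ := C / K with hl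
  have hl0 : 0 < l := by positivity
  set R : ℝ := (1 + Real.log B) / l with hR
  have hlogB := Real.log_nonneg hB1
  have hR0 : 0 ≤ R := by positivity
  -- The rate is the smaller of the two tail exponents; D = √R + 1 ensures both D² ≥ R and D ≥ 1.
  refine ⟨min 1 (49 / (24576 * Real.exp (K / 2))), √R + 1, by positivity,
    by linarith [Real.sqrt_nonneg R], ?_⟩
  intro Ω _ P _ n p A hn hA v hv
  have hn' : (0 : ℝ) < n := by exact_mod_cast hn
  have hind := hA.iIndepFun_rowForm hn v
  have hsub := hA.hasSubgaussianMGF_rowForm hn hK hv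
  constructor
  · refine (measureReal_mono fun ω hω => ?_).trans
      ((measure_sum_sq_le_le hind hsub (hA.integral_rowForm_sq hn hG hv)).trans
        (Real.exp_le_exp.2 ?_))
    · rw [Set.mem_ofPred_eq] at hω ⊢
      rw [sum_rowForm_sq, mul_comm]
      refine mul_le_mul_of_nonneg_right ?_ hn'.le
      nlinarith [norm_nonneg ((A ω).toEuclideanLin v)]
    · exact mul_le_mul_of_nonneg_right (neg_le_neg (min_le_right _ _)) hn'.le
  · have hfin : ∀ i, ∫⁻ ω, ENNReal.ofReal (Real.exp (l * rowForm A v i ω ^ 2)) ∂P ≤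
        ENNReal.ofReal B := fun i => by
      refine ((hsub i).lintegral_exp_sq_le hK0 hC.le).trans_eq ?_
      rw [hB, ofReal_integral_eq_lintegral_ofReal hCint (ae_of_all _ fun _ => (Real.exp_pos _).le)]
    have hint : ∀ i, Integrable (fun ω => Real.exp (l * rowForm A v i ω ^ 2)) P := fun i => by
      have hm := (hsub i).aemeasurable
      refine ⟨by fun_prop, ?_⟩
      rw [hasFiniteIntegral_iff_ofReal (ae_of_all _ fun _ => (Real.exp_pos _).le)]
      exact (hfin i).trans_lt ENNReal.ofReal_lt_top
    have hmgf : ∀ i, mgf (fun ω => rowForm A v i ω ^ 2) P l ≤ B := fun i => by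
      have := hfin i
      rwa [← ofReal_integral_eq_lintegral_ofReal (hint i)
        (ae_of_all _ fun _ => (Real.exp_pos _).le),
        ENNReal.ofReal_le_ofReal_iff (by linarith)] at this
    refine (measureReal_mono fun ω hω => ?_).trans
      ((measure_sum_sq_ge_le hind (fun i => (hsub i).aemeasurable) hl0 (by linarith) hint
        hmgf).trans (Real.exp_le_exp.2 ?_))
    · rw [Set.mem_ofPred_eq] at hω ⊢
      rw [sum_rowForm_sq, mul_comm]
      refine mul_le_mul_of_nonneg_left ?_ hn'.le
      rw [← hR, ← Real.sq_sqrt hR0]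
      exact pow_le_pow_left₀ (Real.sqrt_nonneg R) (by linarith) 2
    · nlinarith [min_le_left (1 : ℝ) (49 / (24576 * Real.exp (K / 2)))]

/-! ### Counting net points and the union bound. -/

/-- Combines C(p,k) ≤ pᵏ/k! with kᵏ/k! ≤ eᵏ. -/
theorem choose_le_exp_mul_div_pow (p : ℕ) {k : ℕ} (hk : 0 < k) :
    (p.choose k : ℝ) ≤ (p * Real.exp 1 / k) ^ k := by
  have hk' : (0 : ℝ) < k := by exact_mod_cast hk
  have h1 := Nat.choose_le_pow_div (α := ℝ) k p
  have h2 := Real.pow_div_factorial_le_exp (k : ℝ) hk'.le k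
  have hf : (0 : ℝ) < k.factorial := by exact_mod_cast k.factorial_pos
  refine h1.trans ?_
  rw [div_le_iff₀ hf] at h2 ⊢
  have h3 : Real.exp k = Real.exp 1 ^ k := by rw [← Real.exp_nat_mul, mul_one]
  rw [div_pow, mul_pow, ← h3, div_mul_eq_mul_div, le_div_iff₀ (by positivity), mul_assoc]
  exact mul_le_mul_of_nonneg_left h2 (by positivity)

/-- The number of points in a union of nets over all coordinate subspaces of dimension `k` is
at most `exp (c n)` once `k` is a small multiple of `n / log (e p / n)`. -/
theorem choose_mul_pow_le_exp {n p k : ℕ} (hn : 0 < n) (hnp : n ≤ p) (hk : 0 < k) {R η c : ℝ}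
    (hR : 1 ≤ R) (hη0 : 0 < η) (hη1 : η ≤ 1) (hηc : η * (3 + Real.log R) ≤ c)
    (hkn : k * Real.log (p * Real.exp 1 / n) ≤ η ^ 2 * n) :
    (p.choose k : ℝ) * R ^ k ≤ Real.exp (c * n) := by
  have hn' : (0 : ℝ) < n := by exact_mod_cast hn
  have hk' : (0 : ℝ) < k := by exact_mod_cast hk
  have hp' : (0 : ℝ) < p := hn'.trans_le (by exact_mod_cast hnp)
  have hL : 1 ≤ Real.log (p * Real.exp 1 / n) := by
    rw [Real.le_log_iff_exp_le (by positivity), le_div_iff₀ hn', mul_comm]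
    exact mul_le_mul_of_nonneg_right (by exact_mod_cast hnp) (Real.exp_pos 1).le
  have hlogR := Real.log_nonneg hR
  have hkη : (k : ℝ) ≤ η ^ 2 * n := by nlinarith
  have hsplit : p * Real.exp 1 / k = (p * Real.exp 1 / n) * (n / k) := by field_simp
  -- From log t ≤ 2√t, k·log(n/k) ≤ 2√(kn) ≤ 2ηn; the square root is why k is limited by η² rather
  -- than η. The exponent totals η² + 2η + η² log R ≤ η(3 + log R), times n.
  have hlognk : k * Real.log (n / k) ≤ 2 * η * n := by
    have hsq : Real.log (n / k) = 2 * Real.log √(n / k : ℝ) := by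
      rw [Real.log_sqrt (by positivity)]; ring
    have h1 : Real.log √(n / k : ℝ) ≤ √(n / k : ℝ) :=
      Real.log_le_self (Real.sqrt_nonneg _)
    have h2 : k * √(n / k : ℝ) ≤ η * n := by
      refine abs_le_of_sq_le_sq' ?_ (by positivity) |>.2
      rw [mul_pow, Real.sq_sqrt (by positivity)]
      have : (k : ℝ) ^ 2 * (n / k) = k * n := by field_simp
      rw [this, mul_pow]
      nlinarith
    rw [hsq]
    nlinarith
  calc (p.choose k : ℝ) * R ^ k ≤ (p * Real.exp 1 / k) ^ k * R ^ k := by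
        gcongr
        exact choose_le_exp_mul_div_pow p hk
    _ = Real.exp (k * (Real.log (p * Real.exp 1 / n) + Real.log (n / k) + Real.log R)) := by
        rw [← Real.log_mul (by positivity) (by positivity), ← hsplit,
          ← Real.log_mul (by positivity) (by positivity), Real.exp_nat_mul,
          Real.exp_log (by positivity), mul_pow]
    _ ≤ _ := by
        refine Real.exp_le_exp.2 ?_
        have h3 : k * Real.log R ≤ η ^ 2 * n * Real.log R := by gcongr
        have h4 : η ^ 2 ≤ η := by nlinarith
        have h5 : η ^ 2 * n * (1 + Real.log R) ≤ η * n * (1 + Real.log R) := by gcongr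
        have h6 : η * (3 + Real.log R) * n ≤ c * n := by gcongr
        nlinarith

/-- A union bound over nets: tail bounds for fixed unit vectors imply a restricted isometry
property. -/
theorem exists_event_restricted_isometry {Ω : Type*} [MeasurableSpace Ω] {P : Measure Ω}
    [IsProbabilityMeasure P] {n p k : ℕ} {A : Ω → Matrix (Fin n) (Fin p) ℝ} {D b : ℝ} (hD : 1 ≤ D)
    (hb : 0 ≤ b)
    (htail : ∀ v : EuclideanSpace ℝ (Fin p), ‖v‖ = 1 →
      P.real {ω | ‖(A ω).toEuclideanLin v‖ ≤ 3 / 4} ≤ b ∧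
      P.real {ω | D ≤ ‖(A ω).toEuclideanLin v‖} ≤ b) :
    ∃ E : Set Ω, MeasurableSet E ∧ 1 - (p.choose k) * (1 + 16 * D) ^ k * (2 * b) ≤ P.real E ∧
      ∀ ω ∈ E, ∀ T : Finset (Fin p), T.card = k → ∀ u ∈ supportedIn T,
        1 / 2 * ‖u‖ ≤ ‖(A ω).toEuclideanLin u‖ ∧ ‖(A ω).toEuclideanLin u‖ ≤ 2 * D * ‖u‖ := by
  have hε : 0 < 1 / (8 * D) := by positivity
  choose N hNcard hNunit hNnet using fun T : Finset (Fin p) =>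
    exists_finset_net_sphere (supportedIn T) hε
  set bad : Set Ω := ⋃ T ∈ Finset.powersetCard k (Finset.univ : Finset (Fin p)), ⋃ u ∈ N T,
    ({ω | ‖(A ω).toEuclideanLin u.1‖ ≤ 3 / 4} ∪ {ω | D ≤ ‖(A ω).toEuclideanLin u.1‖}) with hbad
  have hmeas : P.real bad ≤ (p.choose k) * (1 + 16 * D) ^ k * (2 * b) := by
    have hT : ∀ T ∈ Finset.powersetCard k (Finset.univ : Finset (Fin p)),
        P.real (⋃ u ∈ N T, ({ω | ‖(A ω).toEuclideanLin u.1‖ ≤ 3 / 4} ∪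
          {ω | D ≤ ‖(A ω).toEuclideanLin u.1‖})) ≤ (1 + 16 * D) ^ k * (2 * b) := by
      intro T hT
      rw [Finset.mem_powersetCard] at hT
      refine (measureReal_biUnion_finset_le _ _).trans
        ((Finset.sum_le_card_nsmul _ _ (2 * b) fun u hu => ?_).trans ?_)
      · obtain ⟨h1, h2⟩ := htail u.1 (hNunit T u hu)
        exact (measureReal_union_le _ _).trans (by linarith)
      · rw [nsmul_eq_mul]
        refine mul_le_mul_of_nonneg_right ((hNcard T).trans ?_) (by linarith)
        have h16 : 1 + 2 / (1 / (8 * D)) = 1 + 16 * D := by field_simp; ring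
        rw [h16]
        exact pow_le_pow_right₀ (by linarith) ((finrank_supportedIn_le T).trans hT.2.le)
    refine (measureReal_biUnion_finset_le _ _).trans
      ((Finset.sum_le_card_nsmul _ _ _ hT).trans_eq ?_)
    rw [Finset.card_powersetCard, Finset.card_univ, Fintype.card_fin, nsmul_eq_mul, mul_assoc]
  -- The entries are only almost everywhere measurable, so the bad set is replaced by a measurable
  -- hull of equal measure.
  refine ⟨(toMeasurable P bad)ᶜ, (measurableSet_toMeasurable P bad).compl, ?_, ?_⟩
  · rw [probReal_compl_eq_one_sub (measurableSet_toMeasurable P bad), measureReal_def,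
      measure_toMeasurable, ← measureReal_def]
    linarith
  · intro ω hω T hT u hu
    have hω' : ω ∉ bad := fun h => hω (subset_toMeasurable P bad h)
    have hgood : ∀ u ∈ N T, ¬‖(A ω).toEuclideanLin u.1‖ ≤ 3 / 4 ∧
        ¬D ≤ ‖(A ω).toEuclideanLin u.1‖ := by
      intro u hu
      rw [← not_or]
      intro h
      refine hω' ?_
      rw [hbad]
      simp only [Set.mem_iUnion]
      exact ⟨T, Finset.mem_powersetCard.2 ⟨Finset.subset_univ T, hT⟩, u, hu, h⟩
    exact norm_bounds_of_net ((A ω).toEuclideanLin ∘ₗ (supportedIn T).subtype) hD (N T)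
      (hNnet T) (fun u hu => (not_le.1 (hgood u hu).1).le)
      (fun u hu => (not_le.1 (hgood u hu).2).le) ⟨u, hu⟩

/-- Sub-Gaussian matrices control the `ℓ₂` norm of every vector by the norm of its image and its
`ℓ₁` norm. -/
theorem IsStandardSubGaussian.exists_norm_le {G : Measure ℝ} (hG : IsStandardSubGaussian G) :
    ∃ c C : ℝ, 0 < c ∧ 0 < C ∧ ∀ {Ω : Type*} [MeasurableSpace Ω] {P : Measure Ω}
      [IsProbabilityMeasure P] {n p : ℕ} {A : Ω → Matrix (Fin n) (Fin p) ℝ},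
      0 < n → n ≤ p → IsIIDScaledSample P G A →
      ∃ E : Set Ω, MeasurableSet E ∧ 1 - 2 * Real.exp (-c * n) ≤ P.real E ∧ ∀ ω ∈ E,
        ∀ h : EuclideanSpace ℝ (Fin p), ‖h‖ ≤ 2 * ‖(A ω).toEuclideanLin h‖ +
          C * (l1Norm h * √(Real.log (p * Real.exp 1 / n) / n)) := by
  obtain ⟨κ, D, hκ, hD, htail⟩ := hG.exists_tail_bounds
  have hlogR : 0 ≤ Real.log (1 + 16 * D) := Real.log_nonneg (by linarith)
  -- With this η the net count uses at most half of the tail rate κ.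
  set η : ℝ := min 1 (κ / 2 / (3 + Real.log (1 + 16 * D))) with hη
  have hη0 : 0 < η := lt_min one_pos (by positivity)
  have hη1 : η ≤ 1 := min_le_left _ _
  have hηκ : η * (3 + Real.log (1 + 16 * D)) ≤ κ / 2 := by
    rw [← le_div_iff₀ (by positivity)]
    exact min_le_right _ _
  refine ⟨κ / 2, (4 * D + 1) * (2 / η), by positivity, by positivity, ?_⟩
  intro Ω _ P _ n p A hn hnp hA
  have hn' : (0 : ℝ) < n := by exact_mod_cast hn
  have hp' : (0 : ℝ) < p := hn'.trans_le (by exact_mod_cast hnp)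
  set L : ℝ := Real.log (p * Real.exp 1 / n) with hLdef
  have hL : 1 ≤ L := by
    rw [hLdef, Real.le_log_iff_exp_le (by positivity), le_div_iff₀ hn', mul_comm]
    exact mul_le_mul_of_nonneg_right (by exact_mod_cast hnp) (Real.exp_pos 1).le
  set k : ℕ := ⌊η ^ 2 * n / L⌋₊ with hkdef
  have hkle : (k : ℝ) ≤ η ^ 2 * n / L := Nat.floor_le (by positivity)
  have hklt : η ^ 2 * n / L < k + 1 := Nat.lt_floor_add_one _
  rcases Nat.eq_zero_or_pos k with hk0 | hk
  -- When k = 0, η² < L/n, and the trivial bound ‖h‖ ≤ ‖h‖₁ already suffices for every outcome.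
  · refine ⟨Set.univ, MeasurableSet.univ, ?_, fun ω _ h => ?_⟩
    · rw [probReal_univ]
      linarith [Real.exp_pos (-(κ / 2) * n)]
    · have h1 : η ≤ √(L / n) := by
        refine Real.le_sqrt_of_sq_le ?_
        rw [hk0, Nat.cast_zero, zero_add, div_lt_one (by linarith)] at hklt
        rw [le_div_iff₀ hn']
        exact hklt.le
      have h2 : 1 ≤ (4 * D + 1) * (2 / η) * √(L / n) := by
        have h3 : 2 ≤ 2 / η * √(L / n) := by
          calc (2 : ℝ) = 2 / η * η := by field_simp
            _ ≤ _ := by gcongr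
        nlinarith
      have h4 := mul_le_mul_of_nonneg_left h2 (l1Norm_nonneg h)
      have h5 := norm_le_l1Norm h
      have h6 := norm_nonneg ((A ω).toEuclideanLin h)
      linarith
  · have hk' : (1 : ℝ) ≤ k := by exact_mod_cast hk
    have hkL : k * L ≤ η ^ 2 * n := (le_div_iff₀ (by linarith)).1 hkle
    have hkn : k ≤ n := by
      have h1 : (k : ℝ) ≤ k * L := le_mul_of_one_le_right (by linarith) hL
      have h2 : η ^ 2 * n ≤ n := mul_le_of_le_one_left hn'.le (pow_le_one₀ hη0.le hη1)
      exact_mod_cast h1.trans (hkL.trans h2)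
    obtain ⟨E, hE, hPE, hRIP⟩ := exists_event_restricted_isometry (P := P) (A := A) (k := k) hD
      (Real.exp_pos (-κ * n)).le (htail hn hA)
    refine ⟨E, hE, le_trans ?_ hPE, fun ω hω h => ?_⟩
    · have h1 := choose_mul_pow_le_exp hn hnp hk (R := 1 + 16 * D) (by linarith) hη0 hη1 hηκ hkL
      have h2 : Real.exp (κ / 2 * n) * Real.exp (-κ * n) = Real.exp (-(κ / 2) * n) := by
        rw [← Real.exp_add]
        congr 1
        ring
      have h3 := mul_le_mul_of_nonneg_right h1 (Real.exp_pos (-κ * n)).le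
      rw [h2] at h3
      linarith
    · have h1 := norm_le_of_restricted_isometry hk (hkn.trans hnp) (A ω).toEuclideanLin
        (D := 2 * D) (by linarith) (fun T hT u hu => (hRIP ω hω T hT u hu).1)
        (fun T hT u hu => (hRIP ω hω T hT u hu).2) h
      -- For k ≥ 1 the floor loses at most a factor 2: η²n/L < k + 1 ≤ 2k.
      have h2 : 1 / √(k : ℝ) ≤ 2 / η * √(L / n) := by
        rw [div_le_iff₀ (Real.sqrt_pos.2 (by linarith)), mul_assoc, ← Real.sqrt_mul (by positivity),
          ← div_le_iff₀' (by positivity), one_div_div]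
        refine Real.le_sqrt_of_sq_le ?_
        rw [div_pow, div_mul_eq_mul_div, le_div_iff₀ hn']
        rw [div_lt_iff₀ (by linarith)] at hklt
        nlinarith
      have h3 : l1Norm h / √k ≤ l1Norm h * (2 / η * √(L / n)) := by
        rw [div_eq_mul_one_div]
        exact mul_le_mul_of_nonneg_left h2 (l1Norm_nonneg h)
      have h4 := mul_le_mul_of_nonneg_left h3 (by linarith : 0 ≤ 2 * (2 * D) + 1)
      linarith

/-! ### Basis Pursuit Denoising. -/

theorem IsBPDNSolution.l1Norm_sub_le {n p : ℕ} {A : Matrix (Fin n) (Fin p) ℝ}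
    {y : EuclideanSpace ℝ (Fin n)} {r : ℝ} {v x : EuclideanSpace ℝ (Fin p)}
    (hv : IsBPDNSolution A y r v) (hx : ‖A.toEuclideanLin x - y‖ ≤ r) :
    l1Norm (v - x) ≤ 2 * l1Norm x := by
  linarith [_root_.l1Norm_sub_le v x, hv.2 x hx]

theorem IsBPDNSolution.norm_toEuclideanLin_sub_le {n p : ℕ} {A : Matrix (Fin n) (Fin p) ℝ}
    {y : EuclideanSpace ℝ (Fin n)} {r : ℝ} {v x : EuclideanSpace ℝ (Fin p)}
    (hv : IsBPDNSolution A y r v) (hx : ‖A.toEuclideanLin x - y‖ ≤ r) :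
    ‖A.toEuclideanLin (v - x)‖ ≤ 2 * r := by
  have h : A.toEuclideanLin (v - x) = (A.toEuclideanLin v - y) - (A.toEuclideanLin x - y) := by
    rw [map_sub]; abel
  rw [h]
  linarith [norm_sub_le (A.toEuclideanLin v - y) (A.toEuclideanLin x - y), hv.1]

theorem proposition1 :
    ∃ c₂ : ℝ, 0 < c₂ ∧
      ∀ G₀ : Measure ℝ, IsStandardSubGaussian G₀ →
        ∃ c₁ c₃ : ℝ, 0 < c₁ ∧ 0 < c₃ ∧
          ∀ (n p : ℕ), 0 < n → Real.log (p * Real.exp 1 / n) ≤ n → n ≤ p →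
          ∀ x : EuclideanSpace ℝ (Fin p), x ≠ 0 →
          ∀ (σ ε₀ : ℝ), 0 ≤ σ →
          ∀ (Ω : Type*) [MeasurableSpace Ω] (P : Measure Ω) [IsProbabilityMeasure P]
            (A : Ω → Matrix (Fin n) (Fin p) ℝ) (ε : Ω → EuclideanSpace ℝ (Fin n)),
            IsIIDScaledSample P G₀ A →
            AEMeasurable ε P →
            (∀ ω, ‖ε ω‖ ≤ ε₀) →
            ∃ E : Set Ω, MeasurableSet E ∧ 1 - 2 * Real.exp (-c₁ * n) ≤ P.real E ∧
              ∀ ω ∈ E, ∀ xhat : EuclideanSpace ℝ (Fin p),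
                IsBPDNSolution (A ω) ((A ω).toEuclideanLin x + σ • ε ω) (σ * ε₀) xhat →
                ‖xhat - x‖ / ‖x‖ ≤
                  c₂ * (σ * ε₀ / ‖x‖) +
                    c₃ * √(numericalSparsity 2 x * Real.log (p * Real.exp 1 / n) / n) := by
  -- 4 is the factor 2 of `exists_norm_le` times the 2 in ‖Ah‖ ≤ 2σε₀. It is absolute because the
  -- lower isometry constant 1/2 is; the dependence on G₀ through D enters only c₃.
  refine ⟨4, by norm_num, fun G₀ hG => ?_⟩
  obtain ⟨c, C, hc, hC, H⟩ := hG.exists_norm_le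
  refine ⟨c, 2 * C, hc, by positivity, ?_⟩
  intro n p hn _ hnp x hx σ ε₀ hσ Ω _ P _ A ε hA _ hε
  obtain ⟨E, hE, hPE, hbound⟩ := H hn hnp hA
  refine ⟨E, hE, hPE, fun ω hω xhat hxhat => ?_⟩
  have hx0 : 0 < ‖x‖ := norm_pos_iff.2 hx
  have hfeas : ‖(A ω).toEuclideanLin x - ((A ω).toEuclideanLin x + σ • ε ω)‖ ≤ σ * ε₀ := by
    rw [sub_add_cancel_left, norm_neg, norm_smul, Real.norm_of_nonneg hσ]
    exact mul_le_mul_of_nonneg_left (hε ω) hσ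
  have h1 := hbound ω hω (xhat - x)
  have h2 := hxhat.norm_toEuclideanLin_sub_le hfeas
  have h3 := mul_le_mul_of_nonneg_right (hxhat.l1Norm_sub_le hfeas)
    (Real.sqrt_nonneg (Real.log (p * Real.exp 1 / n) / n))
  have h4 := mul_le_mul_of_nonneg_left h3 hC.le
  have hs : √(numericalSparsity 2 x * Real.log (p * Real.exp 1 / n) / n) =
      l1Norm x / ‖x‖ * √(Real.log (p * Real.exp 1 / n) / n) := by
    rw [numericalSparsity_two, ← div_pow, mul_div_assoc, Real.sqrt_mul (sq_nonneg _),
      Real.sqrt_sq (div_nonneg (l1Norm_nonneg x) hx0.le)]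
  rw [hs, div_le_iff₀ hx0]
  calc ‖xhat - x‖ ≤ 4 * (σ * ε₀) +
        2 * C * (l1Norm x * √(Real.log (p * Real.exp 1 / n) / n)) := by linarith
    _ = _ := by field_simp
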